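/- Let $q$ be a prime power, let $n\ge 1$ with $\gcd(n,q)=1$, and let $C\subseteq\mathbb F_{q^2}^n$ be a cyclic $[n,k,d]_{q^2}$ code, that is, a $k$-dimensional linear code closed under cyclic shifts, with $d$ the smallest Hamming weight of a nonzero codeword. Let $C^{\perp_h}=\{x\in\mathbb F_{q^2}^n : \sum_i x_i c_i^q=0 \text{ for all } c\in C\}$ be its Hermitian dual. Fix a primitive $n$-th root of unity $\alpha$ in an extension field of $\mathbb F_{q^2}$. For a cyclic code $D$ of length $n$, let $$Z(D)=\Big\{i\in\{0,\dots,n-1\} : \sum_{j=0}^{n-1}c_j\alpha^{ij}=0 \text{ for all } c\in D\Big\}$$ be its defining set (the exponents of the zeros $\alpha^i$ of its generator polynomial). An $[[n,K,d;c]]_q$ QUENTA code (entanglement-assisted quantum error-correcting code) is given by an isometry $V:(\mathbb C^q)^{\otimes K}\otimes(\mathbb C^q)^{\otimes c}\to(\mathbb C^q)^{\otimes n}$. Its code space is the set of vectors $(V\otimes 1)(\varphi\otimes\Phi)$ with $\varphi\in(\mathbb C^q)^{\otimes K}$, where $\Phi=q^{-c/2}\sum_a|a\rangle\otimes|a\rangle$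 is the state of $c$ maximally entangled pairs of qudits shared by sender and receiver; $V$ acts on $\varphi$ and on the sender's halves. The code is required to have minimum distance at least $d$ against errors on the $n$ transmitted qudits: if $P$ is the orthogonal projector onto the code space, then for every operator $E$ on $(\mathbb C^q)^{\otimes n}$ acting as the identity on all but fewer than $d$ qudits, $P(E\otimes 1)P=\mu_E P$ for a scalar $\mu_E$, where, by the usual convention for one-dimensional code spaces, $\mu_E=\operatorname{tr}(E)/q^n$ is required if $K=0$. Then $\dim(C^{\perp_h}\cap C)=|Z(C^{\perp_h})\cap Z(C)|$, the numbers $k-|Z(C^{\perp_h})\cap Z(C)|$ and $n-k-|Z(C^{\perp_h})\cap Z(C)|$ are nonnegative, and there is a QUENTA code with parameters $$[[\,n,\;k-|Z(C^{\perp_h})\cap Z(C)|,\;d;\;n-k-|Z(C^{\perp_h})\cap Z(C)|\,]]_q .$$ -/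

import Mathlib

open scoped Kronecker Matrix

namespace QUENTA

section Classical

variable {F : Type*} [Field F] {n : ℕ}

/-- A linear code of length `n` is cyclic if it is closed under the cyclic shift
`(c₀, c₁, …, cₙ₋₁) ↦ (cₙ₋₁, c₀, …, cₙ₋₂)`. -/
def IsCyclicCode [NeZero n] (C : Submodule F (Fin n → F)) : Prop :=
  ∀ c ∈ C, (fun i : Fin n => c (i - 1)) ∈ C

/-- `C` is an `[n, k, d]` code: it has dimension `k`, and `d` is the smallest Hamming weight of a
nonzero codeword (so a code with these parameters has a nonzero codeword). -/
def HasParameters [DecidableEq F] (C : Submodule F (Fin n → F)) (k d : ℕ) : Prop :=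
  Module.finrank F C = k ∧ IsLeast {w : ℕ | ∃ c ∈ C, c ≠ 0 ∧ hammingNorm c = w} d

/-- The Hermitian dual `{x | ∀ c ∈ C, ∑ i, x i * (c i) ^ q = 0}` of a code over the field with
`q ^ 2` elements. -/
def hermitianDual (q : ℕ) (C : Submodule F (Fin n → F)) : Submodule F (Fin n → F) where
  carrier := {x | ∀ c ∈ C, ∑ i, x i * c i ^ q = 0}
  zero_mem' := by
    intro c _
    simp
  add_mem' := by
    intro x y hx hy c hc
    simp [add_mul, Finset.sum_add_distrib, hx c hc, hy c hc]
  smul_mem' := by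
    intro a x hx c hc
    simp [mul_assoc, ← Finset.mul_sum, hx c hc]

/-- The polynomial `c₀ + c₁ X + ⋯ + cₙ₋₁ X ^ (n - 1)` of a word. -/
noncomputable def codePoly (c : Fin n → F) : Polynomial F :=
  ∑ j : Fin n, Polynomial.monomial (j : ℕ) (c j)

/-- The defining set `Z(C)` of a cyclic code with respect to a primitive `n`-th root of unity `α`
in an extension field: the exponents `i` in `{0, …, n - 1}` for which `α ^ i` is a zero of all
code polynomials (equivalently, of the generator polynomial). -/
def definingSet {L : Type*} [Field L] [Algebra F L] (α : L) (C : Submodule F (Fin n → F)) :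
    Set (Fin n) :=
  {i | ∀ c ∈ C, Polynomial.aeval (α ^ (i : ℕ)) (codePoly c) = 0}

end Classical

/-- Labels of the computational basis of `m` qudits of dimension `q`, that is of `(ℂ^q)^{⊗ m}`. -/
abbrev Labels (q m : ℕ) : Type := Fin m → Fin q

/-- The operator `E` on `n` qudits acts as the identity outside the positions in `S`:
it is `M ⊗ 1` for an operator `M` on the qudits in `S`. -/
def ActsOn {q n : ℕ} (S : Finset (Fin n)) (E : Matrix (Labels q n) (Labels q n) ℂ) : Prop :=
  ∃ M : Matrix (S → Fin q) (S → Fin q) ℂ, ∀ y z : Labels q n,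
    E y z = if ∀ i, i ∉ S → y i = z i then M (fun i => y i) (fun i => z i) else 0

/-- Amplitudes of `c` maximally entangled pairs of qudits,
`q ^ (-c / 2) • ∑ a, |a⟩ ⊗ |a⟩`: the first factor is held by the sender, the second by the
receiver. -/
noncomputable def maxEntangled (q c : ℕ) (a b : Labels q c) : ℂ :=
  if a = b then ((Real.sqrt ((q : ℝ) ^ c))⁻¹ : ℝ) else 0

/-- The map that prepares the encoded states: a logical state `|x⟩` of `K` qudits, together with
the sender's halves of `c` maximally entangled pairs, is mapped into the `n` transmitted qudits
by `V`, while the receiver's halves are left alone. -/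
noncomputable def encodingMatrix {q n K c : ℕ}
    (V : Matrix (Labels q n) (Labels q K × Labels q c) ℂ) :
    Matrix (Labels q n × Labels q c) (Labels q K) ℂ :=
  Matrix.of fun yb x => ∑ a : Labels q c, V yb.1 (x, a) * maxEntangled q c a yb.2

/-- The orthogonal projector onto the space of encoded states
(`encodingMatrix V` is an isometry if `V` is). -/
noncomputable def codeProjector {q n K c : ℕ}
    (V : Matrix (Labels q n) (Labels q K × Labels q c) ℂ) :
    Matrix (Labels q n × Labels q c) (Labels q n × Labels q c) ℂ :=
  encodingMatrix V * (encodingMatrix V)ᴴ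

/-- There is an `[[n, K, d; c]]_q` entanglement-assisted quantum error-correcting code.
The sender encodes `K` logical qudits and the own halves of `c` maximally entangled pairs into `n`
qudits by an isometry `V` (a unitary applied to logical qudits, halves and ancillas in a fixed
state). Errors act on the `n` transmitted qudits only, and the code has minimum distance at
least `d`: for `P` the projector onto the code space, every error `E` acting on fewer than `d`
qudits is detected, `P (E ⊗ 1) P = μ P` for some scalar `μ`. By the usual convention a code with a
one-dimensional code space (`K = 0`), for which this holds trivially, is required to be pure,
that is `μ = tr E / q ^ n`. -/
def ExistsCode (q n K d c : ℕ) : Prop :=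
  ∃ V : Matrix (Labels q n) (Labels q K × Labels q c) ℂ,
    Vᴴ * V = 1 ∧
    ∀ S : Finset (Fin n), S.card < d →
      ∀ E : Matrix (Labels q n) (Labels q n) ℂ, ActsOn S E →
        ∃ μ : ℂ,
          codeProjector V * (E ⊗ₖ (1 : Matrix (Labels q c) (Labels q c) ℂ)) * codeProjector V =
            μ • codeProjector V ∧
          (K = 0 → μ = E.trace / (q : ℂ) ^ n)

end QUENTA

namespace QUENTA

/-- In a field with `q ^ 2` elements, the map `x ↦ x ^ q` is an involutive ring homomorphism. -/
theorem exists_frobenius {F : Type*} [Field F] [Fintype F] {q : ℕ} (hq : IsPrimePow q)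
    (hF : Fintype.card F = q ^ 2) :
    ∃ σ : F →+* F, (∀ x, σ x = x ^ q) ∧ ∀ x, σ (σ x) = x := by
  obtain ⟨p, e, hp, he, rfl⟩ := hq
  have hp' : p.Prime := hp.nat_prime
  have : Fact p.Prime := ⟨hp'⟩
  have : CharP F p := by
    rw [← pow_mul] at hF
    exact charP_of_card_eq_prime_pow hF
  refine ⟨iterateFrobenius F p e, fun x => iterateFrobenius_def .., fun x => ?_⟩
  rw [iterateFrobenius_def, iterateFrobenius_def, ← pow_mul, ← sq, ← hF, FiniteField.pow_card]

/-- A field with `q ^ 2` elements contains a field with `q` elements. -/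
theorem exists_subfield {F : Type*} [Field F] [Fintype F] {q : ℕ} (hq : IsPrimePow q)
    (hF : Fintype.card F = q ^ 2) :
    ∃ (k : Type) (_ : Field k) (_ : Fintype k) (_ : k →+* F), Fintype.card k = q := by
  obtain ⟨p, e, hp, he, rfl⟩ := hq
  have : Fact p.Prime := ⟨hp.nat_prime⟩
  let k := GaloisField p e
  have : Fintype k := Fintype.ofFinite k
  have hk : Nat.card k = p ^ e := GaloisField.card p e he.ne'
  let E := FiniteField.Extension k p 2
  have : Fintype E := Fintype.ofFinite E
  have hE : Fintype.card E = Fintype.card F := by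
    rw [hF, ← Nat.card_eq_fintype_card, FiniteField.natCard_extension, hk]
  refine ⟨k, inferInstance, inferInstance,
    (FiniteField.ringEquivOfCardEq hE : E →+* F).comp (algebraMap k E), ?_⟩
  rw [← Nat.card_eq_fintype_card, hk]

section Heisenberg

variable {k : Type*} [Field k] [Fintype k] [DecidableEq k]

/-- The operator `X ^ a Z ^ b` on functions on a finite field, for a given additive character. -/
def shiftPhase (ψ : AddChar k ℂ) (a b : k) : Matrix k k ℂ :=
  Matrix.of fun y x => if y = x + a then ψ (b * x) else 0

theorem shiftPhase_zero (ψ : AddChar k ℂ) : shiftPhase ψ 0 0 = 1 := by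
  ext y x
  simp [shiftPhase, Matrix.one_apply]

theorem shiftPhase_mul (ψ : AddChar k ℂ) (a b a' b' : k) :
    shiftPhase ψ a b * shiftPhase ψ a' b' = ψ (b * a') • shiftPhase ψ (a + a') (b + b') := by
  ext y x
  simp only [shiftPhase, Matrix.mul_apply, Matrix.of_apply, Matrix.smul_apply, smul_eq_mul]
  rw [Finset.sum_eq_single (x + a')]
  · simp only [if_true, add_assoc, add_comm a a']
    split_ifs
    · rw [← AddChar.map_add_eq_mul, ← AddChar.map_add_eq_mul]
      congr 1
      ring
    · simp
  · intro z _ hz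
    simp [hz]
  · simp

theorem norm_addChar (ψ : AddChar k ℂ) (x : k) : ‖ψ x‖ = 1 := AddChar.norm_apply ψ x

theorem star_addChar (ψ : AddChar k ℂ) (x : k) : star (ψ x) = ψ (-x) := by
  rw [AddChar.map_neg_eq_conj]
  rfl

theorem shiftPhase_unitary (ψ : AddChar k ℂ) (a b : k) :
    (shiftPhase ψ a b)ᴴ * shiftPhase ψ a b = 1 := by
  ext y x
  simp only [shiftPhase, Matrix.mul_apply, Matrix.of_apply, Matrix.conjTranspose_apply,
    Matrix.one_apply]
  rw [Finset.sum_eq_single (x + a)]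
  · by_cases h : y = x
    · subst h
      simp [star_addChar, ← AddChar.map_add_eq_mul]
    · have : ¬ x = y := fun h' => h h'.symm
      simp [h, this]
  · intro z _ hz
    simp [hz]
  · simp

theorem sum_addChar_mul {ψ : AddChar k ℂ} (hψ : ψ ≠ 1) (x : k) :
    ∑ b, ψ (b * x) = if x = 0 then (Fintype.card k : ℂ) else 0 := by
  have hp : ψ.IsPrimitive := AddChar.IsPrimitive.of_ne_one hψ
  have h := AddChar.sum_mulShift x hp
  push_cast at h
  exact h

theorem shiftPhase_trace {ψ : AddChar k ℂ} (hψ : ψ ≠ 1) {a b : k} (h : ¬ (a = 0 ∧ b = 0)) :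
    (shiftPhase ψ a b).trace = 0 := by
  simp only [Matrix.trace, Matrix.diag_apply, shiftPhase, Matrix.of_apply]
  by_cases ha : a = 0
  · have hb : b ≠ 0 := fun hb => h ⟨ha, hb⟩
    subst ha
    simp only [add_zero, if_true, mul_comm b]
    rw [sum_addChar_mul hψ, if_neg hb]
  · simp [ha]

theorem shiftPhase_span {ψ : AddChar k ℂ} (hψ : ψ ≠ 1) (M : Matrix k k ℂ) :
    M = ∑ a, ∑ b, ((Fintype.card k : ℂ)⁻¹ * ∑ x, ψ (-(b * x)) * M (x + a) x) •
      shiftPhase ψ a b := by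
  ext y z
  simp only [Matrix.sum_apply, Matrix.smul_apply, shiftPhase, Matrix.of_apply, smul_eq_mul]
  rw [Finset.sum_eq_single (y - z)]
  · simp only [add_sub_cancel, if_true]
    have hk : (Fintype.card k : ℂ) ≠ 0 := by simp
    have : ∀ b, (Fintype.card k : ℂ)⁻¹ * (∑ x, ψ (-(b * x)) * M (x + (y - z)) x) * ψ (b * z) =
        ∑ x, (Fintype.card k : ℂ)⁻¹ * M (x + (y - z)) x * ψ (b * (z - x)) := by
      intro b
      rw [Finset.mul_sum, Finset.sum_mul]
      refine Finset.sum_congr rfl fun x _ => ?_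
      rw [mul_sub, sub_eq_add_neg (b * z), AddChar.map_add_eq_mul]
      ring
    simp_rw [this]
    rw [Finset.sum_comm]
    simp_rw [← Finset.mul_sum, sum_addChar_mul hψ]
    rw [Finset.sum_eq_single z]
    · simp only [sub_self, if_true, add_sub_cancel]
      field_simp
    · intro x _ hx
      rw [if_neg (sub_ne_zero.2 hx.symm), mul_zero]
    · simp
  · intro a _ ha
    refine Finset.sum_eq_zero fun b _ => ?_
    rw [if_neg, mul_zero]
    rintro rfl
    simp at ha
  · simp

end Heisenberg

/-- Error operators on one qudit of dimension `q`, labelled by a field with an involution `σ`: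
up to phases they form a projective representation of the additive group, and the commutation
relations are given by the form `u * σ v`. -/
structure WeylSystem (F : Type*) [Field F] [Fintype F] (σ : F →+* F) (q : ℕ) where
  /-- The operators. -/
  T : F → Matrix (Fin q) (Fin q) ℂ
  /-- The cocycle. -/
  f : F → F → ℂ
  /-- The character that describes the commutation relations. -/
  χ : AddChar F ℂ
  T_zero : T 0 = 1
  T_mul : ∀ u v, T u * T v = f u v • T (u + v)
  f_comm : ∀ u v, f u v = χ (u * σ v - σ (u * σ v)) * f v u
  norm_f : ∀ u v, ‖f u v‖ = 1
  unitary : ∀ u, (T u)ᴴ * T u = 1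
  trace_T : ∀ u, u ≠ 0 → (T u).trace = 0
  span : ∀ M : Matrix (Fin q) (Fin q) ℂ, ∃ c : F → ℂ, M = ∑ u, c u • T u ∧ c 0 = M.trace / q
  χ_ne : ∃ y, χ (y - σ y) ≠ 1

theorem exists_weylSystem {F : Type*} [Field F] [Fintype F] {q : ℕ} (hq : IsPrimePow q)
    (hF : Fintype.card F = q ^ 2) {σ : F →+* F} (hσ : ∀ x, σ x = x ^ q)
    (hσσ : ∀ x, σ (σ x) = x) : Nonempty (WeylSystem F σ q) := by
  classical
  obtain ⟨k, _, _, i, hk⟩ := exists_subfield hq hF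
  have hq1 : 1 < q := hq.one_lt
  have hik : ∀ a, σ (i a) = i a := fun a => by
    rw [hσ, ← map_pow, ← hk, FiniteField.pow_card]
  obtain ⟨β, hβ⟩ : ∃ β, ∀ a, i a ≠ β := by
    by_contra! h
    have h1 := Fintype.card_le_of_surjective i h
    rw [hF, hk] at h1
    nlinarith
  have hinj : Function.Injective fun p : k × k => i p.1 + i p.2 * β := by
    rintro ⟨a, b⟩ ⟨a', b'⟩ h
    simp only at h
    have hb : b = b' := by
      by_contra hb
      have hb' : i (b - b') ≠ 0 := (map_ne_zero i).2 (sub_ne_zero.2 hb)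
      refine hβ ((a' - a) / (b - b')) ?_
      rw [map_div₀, div_eq_iff hb', map_sub, map_sub]
      linear_combination -h
    subst hb
    rw [i.injective (add_right_cancel h)]
  have hbij : Function.Bijective fun p : k × k => i p.1 + i p.2 * β := by
    rw [Fintype.bijective_iff_injective_and_card]
    exact ⟨hinj, by rw [Fintype.card_prod, hF, hk, sq]⟩
  let e : k × k ≃ F := Equiv.ofBijective _ hbij
  have he : ∀ p, e p = i p.1 + i p.2 * β := fun p => rfl
  have he' : ∀ u, i (e.symm u).1 + i (e.symm u).2 * β = u := fun u => e.apply_symm_apply u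
  have hadd : ∀ u v, e.symm (u + v) = e.symm u + e.symm v := by
    intro u v
    apply e.injective
    rw [e.apply_symm_apply, he]
    simp only [Prod.fst_add, Prod.snd_add, map_add]
    linear_combination -(he' u) - he' v
  have hzero : e.symm 0 = 0 := by
    apply e.injective
    rw [e.apply_symm_apply, he]
    simp
  -- `β` is not fixed by `σ`
  have hδ : β - σ β ≠ 0 := by
    intro h
    have hfix : ∀ x : F, x ^ q = x := by
      intro x
      rw [← hσ, ← he' x, map_add, map_mul, hik, hik, ← sub_eq_zero.1 h]
    have hcard : (Finset.univ : Finset F).card ≤ q := by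
      have hne : (Polynomial.X ^ q - Polynomial.X : Polynomial F) ≠ 0 :=
        FiniteField.X_pow_card_sub_X_ne_zero F hq1
      calc (Finset.univ : Finset F).card
          ≤ (Polynomial.X ^ q - Polynomial.X : Polynomial F).natDegree := by
            apply Polynomial.card_le_degree_of_subset_roots
            intro x _
            simp [Polynomial.mem_roots hne, hfix x]
        _ = q := FiniteField.X_pow_card_sub_X_natDegree_eq F hq1
    rw [Finset.card_univ, hF] at hcard
    nlinarith
  obtain ⟨Ψ, hΨ⟩ : ∃ Ψ : AddChar F ℂ, Ψ ≠ 1 := by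
    have : Nontrivial (AddChar F ℂ) := by
      rw [← Fintype.one_lt_card_iff_nontrivial, ← Nat.card_eq_fintype_card,
        Nat.card_eq_fintype_card, AddChar.card_eq, hF]
      nlinarith
    exact exists_ne 1
  obtain ⟨x₀, hx₀⟩ : ∃ x, Ψ x ≠ 1 := by
    by_contra! h
    exact hΨ (by ext x; simp [h x])
  let χ : AddChar F ℂ := AddChar.mulShift Ψ (x₀ / (β - σ β))
  have hχ : ∀ x, χ x = Ψ (x₀ / (β - σ β) * x) := fun x => rfl
  let ψ : AddChar k ℂ :=
    χ.compAddMonoidHom ((AddMonoidHom.mulLeft (β - σ β)).comp (i : k →+ F))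
  have hψ : ∀ a, ψ a = χ ((β - σ β) * i a) := fun a => rfl
  have hχ1 : χ (β - σ β) ≠ 1 := by
    rw [hχ, div_mul_cancel₀ _ hδ]
    exact hx₀
  have hψ1 : ψ ≠ 1 := by
    intro h
    apply hχ1
    have := hψ 1
    rw [h, map_one i, mul_one] at this
    exact this.symm
  let l : k ≃ Fin q := Fintype.equivFinOfCardEq hk
  let R : Matrix k k ℂ ≃ₐ[ℂ] Matrix (Fin q) (Fin q) ℂ := Matrix.reindexAlgEquiv ℂ ℂ l
  have hRt : ∀ M, (R M).trace = M.trace := fun M => by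
    simp [R, Matrix.trace, ← l.sum_comp]
  have hRs : ∀ M, (R M)ᴴ = R Mᴴ := fun M => by
    ext
    simp [R]
  refine ⟨{
    T := fun u => R (shiftPhase ψ (e.symm u).1 (e.symm u).2)
    f := fun u v => ψ ((e.symm u).2 * (e.symm v).1)
    χ := χ
    T_zero := ?_
    T_mul := ?_
    f_comm := ?_
    norm_f := fun u v => norm_addChar _ _
    unitary := ?_
    trace_T := ?_
    span := ?_
    χ_ne := ⟨β, hχ1⟩ }⟩
  · rw [hzero]
    simp [shiftPhase_zero]
  · intro u v
    rw [← map_mul, shiftPhase_mul, map_smul, hadd]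
    rfl
  · intro u v
    simp only [hψ]
    rw [← AddChar.map_add_eq_mul]
    congr 1
    simp only [map_mul, hσσ]
    have hu := he' u
    have hv := he' v
    generalize e.symm u = a at hu ⊢
    generalize e.symm v = b at hv ⊢
    have hu' := congrArg σ hu
    have hv' := congrArg σ hv
    simp only [map_add, map_mul, hik] at hu' hv'
    rw [← hu', ← hv', ← hu, ← hv]
    ring
  · intro u
    rw [hRs, ← map_mul, shiftPhase_unitary, map_one]
  · intro u hu
    rw [hRt]
    apply shiftPhase_trace hψ1
    rintro ⟨h1, h2⟩
    apply hu
    rw [← he' u, h1, h2]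
    simp
  · intro M
    have h := shiftPhase_span hψ1 (R.symm M)
    refine ⟨fun u => (Fintype.card k : ℂ)⁻¹ * ∑ x, ψ (-((e.symm u).2 * x)) *
      R.symm M (x + (e.symm u).1) x, ?_, ?_⟩
    · rw [← e.sum_comp]
      simp only [e.symm_apply_apply]
      rw [Fintype.sum_prod_type]
      apply R.symm.injective
      rw [map_sum]
      simp only [map_sum, map_smul, R.symm_apply_apply]
      exact h
    · simp only [hzero]
      have : M.trace = (R.symm M).trace := by rw [← hRt, R.apply_symm_apply]
      rw [this]
      simp [Matrix.trace, hk, div_eq_inv_mul]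

section Tensor

variable {ι : Type*} [Fintype ι] [DecidableEq ι] {q : ℕ}

/-- The tensor product of operators on single qudits. -/
def tensor (M : ι → Matrix (Fin q) (Fin q) ℂ) : Matrix (ι → Fin q) (ι → Fin q) ℂ :=
  Matrix.of fun y z => ∏ i, M i (y i) (z i)

theorem tensor_mul (M N : ι → Matrix (Fin q) (Fin q) ℂ) :
    tensor M * tensor N = tensor fun i => M i * N i := by
  ext y z
  simp only [tensor, Matrix.mul_apply, Matrix.of_apply, ← Finset.prod_mul_distrib]
  rw [Finset.prod_univ_sum, Fintype.piFinset_univ]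

theorem tensor_one : tensor (fun _ : ι => (1 : Matrix (Fin q) (Fin q) ℂ)) = 1 := by
  ext y z
  simp only [tensor, Matrix.of_apply, Matrix.one_apply]
  by_cases h : y = z
  · simp [h]
  · rw [if_neg h]
    obtain ⟨i, hi⟩ := Function.ne_iff.1 h
    exact Finset.prod_eq_zero (Finset.mem_univ i) (if_neg hi)

theorem tensor_conjTranspose (M : ι → Matrix (Fin q) (Fin q) ℂ) :
    (tensor M)ᴴ = tensor fun i => (M i)ᴴ := by
  ext y z
  simp [tensor]

theorem trace_tensor (M : ι → Matrix (Fin q) (Fin q) ℂ) :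
    (tensor M).trace = ∏ i, (M i).trace := by
  simp only [tensor, Matrix.trace, Matrix.diag_apply, Matrix.of_apply]
  rw [Finset.prod_univ_sum, Fintype.piFinset_univ]

theorem tensor_smul (c : ι → ℂ) (M : ι → Matrix (Fin q) (Fin q) ℂ) :
    (tensor fun i => c i • M i) = (∏ i, c i) • tensor M := by
  ext y z
  simp [tensor, Finset.prod_mul_distrib]

theorem tensor_sum {A : Type*} [Fintype A] (c : ι → A → ℂ)
    (N : A → Matrix (Fin q) (Fin q) ℂ) :
    (tensor fun i => ∑ u, c i u • N u) =
      ∑ u : ι → A, (∏ i, c i (u i)) • tensor fun i => N (u i) := by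
  ext y z
  simp only [tensor, Matrix.of_apply, Matrix.sum_apply, Matrix.smul_apply, smul_eq_mul]
  rw [Finset.prod_univ_sum, Fintype.piFinset_univ]
  simp only [Finset.prod_mul_distrib]

end Tensor

theorem exists_algHom_complex (A : Type*) [CommRing A] [Nontrivial A] [Algebra ℂ A]
    [Module.Finite ℂ A] : Nonempty (A →ₐ[ℂ] ℂ) := by
  obtain ⟨m, hm⟩ := Ideal.exists_maximal A
  let _ : Field (A ⧸ m) := Ideal.Quotient.field m
  have : Module.Finite ℂ (A ⧸ m) :=
    Module.Finite.of_surjective (Ideal.Quotient.mkₐ ℂ m).toLinearMap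
      (Ideal.Quotient.mkₐ_surjective ℂ m)
  have hbij : Function.Bijective (algebraMap ℂ (A ⧸ m)) :=
    IsAlgClosed.algebraMap_bijective_of_isIntegral
  let e : ℂ ≃ₐ[ℂ] A ⧸ m := AlgEquiv.ofBijective (Algebra.ofId ℂ (A ⧸ m)) hbij
  exact ⟨(e.symm : (A ⧸ m) →ₐ[ℂ] ℂ).comp (Ideal.Quotient.mkₐ ℂ m)⟩

/-- An orthogonal projector of trace `|Y|` has an orthonormal basis of its range indexed by `Y`. -/
theorem exists_isometry_of_projector {X Y : Type*} [Fintype X] [DecidableEq X] [Fintype Y]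
    [DecidableEq Y] (P : Matrix X X ℂ) (hP : P * P = P) (htr : P.trace = (Fintype.card Y : ℂ)) :
    ∃ W : Matrix X Y ℂ, Wᴴ * W = 1 ∧ P * W = W := by
  let f : EuclideanSpace ℂ X →ₗ[ℂ] EuclideanSpace ℂ X := Matrix.toLin
    (EuclideanSpace.basisFun X ℂ).toBasis (EuclideanSpace.basisFun X ℂ).toBasis P
  have hf : ∀ v x, f v x = (P *ᵥ (v : X → ℂ)) x := fun v x => by
    simp [f, Matrix.toLin_apply, Matrix.mulVec, dotProduct, Pi.single_apply]
  have hff : ∀ v, f (f v) = f v := by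
    intro v
    have h2 : f ∘ₗ f = f := by
      simp only [f]
      rw [← Matrix.toLin_mul, hP]
    exact LinearMap.congr_fun h2 v
  have hproj : LinearMap.IsProj (LinearMap.range f) f :=
    ⟨fun v => LinearMap.mem_range_self f v, by rintro _ ⟨v, rfl⟩; exact hff v⟩
  have hfr : Module.finrank ℂ (LinearMap.range f) = Fintype.card Y := by
    have h1 := hproj.trace
    have h2 : LinearMap.trace ℂ _ f = P.trace := by
      simp only [f]
      rw [LinearMap.trace_eq_matrix_trace ℂ (EuclideanSpace.basisFun X ℂ).toBasis,
        LinearMap.toMatrix_toLin]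
    rw [h2, htr] at h1
    exact_mod_cast h1.symm
  let b := (stdOrthonormalBasis ℂ (LinearMap.range f)).reindex
    (Fintype.equivOfCardEq (by rw [Fintype.card_fin, hfr]) : _ ≃ Y)
  refine ⟨Matrix.of fun x y => (b y : EuclideanSpace ℂ X) x, ?_, ?_⟩
  · ext y y'
    have h := orthonormal_iff_ite.1 b.orthonormal y y'
    rw [Submodule.coe_inner, PiLp.inner_apply] at h
    rw [Matrix.mul_apply, Matrix.one_apply, ← h]
    refine Finset.sum_congr rfl fun x _ => ?_
    simp [mul_comm]
  · ext x y
    have h : f (b y) = b y := hproj.map_id _ (b y).2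
    have h' := congrArg (fun v => v x) h
    simp only [hf] at h'
    exact h'

namespace WeylSystem

variable {F : Type*} [Field F] [Fintype F] {σ : F →+* F} {q : ℕ} (w : WeylSystem F σ q)
  {ι : Type*} [Fintype ι] [DecidableEq ι]

/-- Error operators on several qudits. -/
def pauli (u : ι → F) : Matrix (ι → Fin q) (ι → Fin q) ℂ := tensor fun i => w.T (u i)

/-- The cocycle of the error operators on several qudits. -/
noncomputable def cocycle (u v : ι → F) : ℂ := ∏ i, w.f (u i) (v i)

theorem pauli_zero : w.pauli (0 : ι → F) = 1 := by
  simp [pauli, w.T_zero, tensor_one]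

theorem pauli_mul (u v : ι → F) :
    w.pauli u * w.pauli v = w.cocycle u v • w.pauli (u + v) := by
  simp only [pauli, tensor_mul, w.T_mul, tensor_smul, cocycle, Pi.add_apply]

theorem norm_cocycle (u v : ι → F) : ‖w.cocycle u v‖ = 1 := by
  simp [cocycle, norm_prod, w.norm_f]

theorem cocycle_comm (u v : ι → F) :
    w.cocycle u v =
      w.χ (∑ i, u i * σ (v i) - σ (∑ i, u i * σ (v i))) * w.cocycle v u := by
  have hsum : ∀ (s : Finset ι) (g : ι → F), w.χ (∑ i ∈ s, g i) = ∏ i ∈ s, w.χ (g i) := by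
    intro s g
    induction s using Finset.induction_on with
    | empty => simp
    | insert i s hi ih => rw [Finset.sum_insert hi, Finset.prod_insert hi,
        AddChar.map_add_eq_mul, ih]
  rw [map_sum, ← Finset.sum_sub_distrib, hsum, cocycle, cocycle, ← Finset.prod_mul_distrib]
  exact Finset.prod_congr rfl fun i _ => w.f_comm _ _

theorem pauli_unitary (u : ι → F) : (w.pauli u)ᴴ * w.pauli u = 1 := by
  simp only [pauli, tensor_conjTranspose, tensor_mul, w.unitary, tensor_one]

theorem trace_pauli {u : ι → F} (hu : u ≠ 0) : (w.pauli u).trace = 0 := by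
  obtain ⟨i, hi⟩ := Function.ne_iff.1 hu
  rw [pauli, trace_tensor]
  exact Finset.prod_eq_zero (Finset.mem_univ i) (w.trace_T _ hi)

open scoped IsMulCommutative in
variable {w} in
theorem exists_phase {S : Submodule F (ι → F)}
    (hS : ∀ s ∈ S, ∀ t ∈ S, ∑ i, s i * σ (t i) = 0) (hq : q ≠ 0) :
    ∃ θ : S → ℂ, (∀ s t : S, θ s * θ t * w.cocycle (s : ι → F) t = θ (s + t)) ∧ θ 0 = 1 ∧
      ∀ s, ‖θ s‖ = 1 := by
  have : NeZero q := ⟨hq⟩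
  have hcomm : ∀ a ∈ w.pauli '' (S : Set (ι → F)), ∀ b ∈ w.pauli '' (S : Set (ι → F)),
      a * b = b * a := by
    rintro _ ⟨s, hs, rfl⟩ _ ⟨t, ht, rfl⟩
    rw [pauli_mul, pauli_mul, cocycle_comm, hS s hs t ht, add_comm s t]
    simp
  let A := Algebra.adjoin ℂ (w.pauli '' (S : Set (ι → F)))
  have : IsMulCommutative A := Algebra.isMulCommutative_adjoin ℂ hcomm
  let _ : CommRing A := inferInstance
  obtain ⟨φ⟩ := exists_algHom_complex A
  let U : S → A := fun s => ⟨w.pauli s, Algebra.subset_adjoin ⟨s, s.2, rfl⟩⟩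
  have hU : ∀ s t : S, U s * U t = w.cocycle (s : ι → F) t • U (s + t) := fun s t =>
    Subtype.ext (w.pauli_mul (s : ι → F) t)
  have hU0 : U 0 = 1 := Subtype.ext w.pauli_zero
  have hφ : ∀ s t : S, φ (U s) * φ (U t) = w.cocycle (s : ι → F) t * φ (U (s + t)) := by
    intro s t
    rw [← map_mul, hU, map_smul, smul_eq_mul]
  have hφ0 : φ (U 0) = 1 := by rw [hU0, map_one]
  have hn : ∀ s t : S, ‖φ (U (s + t))‖ = ‖φ (U s)‖ * ‖φ (U t)‖ := by
    intro s t
    rw [← norm_mul, hφ, norm_mul, norm_cocycle, one_mul]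
  have hpow : ∀ (m : ℕ) (s : S), ‖φ (U (m • s))‖ = ‖φ (U s)‖ ^ m := by
    intro m s
    induction m with
    | zero => simp [hφ0]
    | succ m ih => rw [succ_nsmul, hn, ih, pow_succ]
  have hone : ∀ s : S, ‖φ (U s)‖ = 1 := by
    intro s
    have h := hpow (Fintype.card F) s
    have h0 : Fintype.card F • s = 0 := by
      rw [← Nat.cast_smul_eq_nsmul F, Nat.cast_card_eq_zero, zero_smul]
    rw [h0, hφ0, norm_one] at h
    exact (pow_eq_one_iff_of_nonneg (norm_nonneg _) Fintype.card_ne_zero).1 h.symm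
  have hne : ∀ s : S, φ (U s) ≠ 0 := fun s => by
    rw [← norm_ne_zero_iff, hone]
    exact one_ne_zero
  refine ⟨fun s => (φ (U s))⁻¹, ?_, by simp [hφ0], fun s => by simp [hone]⟩
  intro s t
  have h := hφ s t
  have h1 := hne s
  have h2 := hne t
  have h3 := hne (s + t)
  field_simp
  linear_combination -h

/-- The stabilizer construction: an isotropic subspace `S` gives an isometry whose range is
stabilized by the operators of `S` up to phases. -/
theorem exists_stabilizer_isometry {S : Submodule F (ι → F)}
    (hS : ∀ s ∈ S, ∀ t ∈ S, ∑ i, s i * σ (t i) = 0) (hq : q ≠ 0) {Y : Type*} [Fintype Y]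
    [DecidableEq Y] (hY : Fintype.card Y * Nat.card S = q ^ Fintype.card ι) :
    ∃ W : Matrix (ι → Fin q) Y ℂ, Wᴴ * W = 1 ∧
      ∀ u : ι → F, (∃ s ∈ S, ∑ i, s i * σ (u i) ≠ 0) → Wᴴ * w.pauli u * W = 0 := by
  classical
  obtain ⟨θ, hθ, hθ0, hθn⟩ := exists_phase (w := w) hS hq
  let U : S → Matrix (ι → Fin q) (ι → Fin q) ℂ := fun s => θ s • w.pauli s
  have hU : ∀ s t, U s * U t = U (s + t) := by
    intro s t
    simp only [U]
    rw [smul_mul_smul_comm, pauli_mul, smul_smul, hθ]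
    rfl
  have hU0 : U 0 = 1 := by
    simp only [U, hθ0, one_smul]
    exact w.pauli_zero
  have hUU : ∀ s, (U s)ᴴ * U s = 1 := by
    intro s
    simp only [U]
    rw [Matrix.conjTranspose_smul, smul_mul_smul_comm, pauli_unitary]
    have : star (θ s) * θ s = 1 := by
      have := Complex.conj_mul' (θ s)
      rw [hθn] at this
      simpa using this
    rw [this, one_smul]
  have hUs : ∀ s, (U s)ᴴ = U (-s) := by
    intro s
    calc (U s)ᴴ = (U s)ᴴ * (U s * U (-s)) := by rw [hU, add_neg_cancel, hU0, mul_one]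
      _ = U (-s) := by rw [← mul_assoc, hUU, one_mul]
  have hN : (Nat.card S : ℂ) ≠ 0 := by
    exact_mod_cast Nat.card_pos.ne'
  let P : Matrix (ι → Fin q) (ι → Fin q) ℂ := (Nat.card S : ℂ)⁻¹ • ∑ s, U s
  have hUP : ∀ s, U s * P = P := by
    intro s
    simp only [P]
    rw [mul_smul_comm, Finset.mul_sum]
    simp only [hU]
    rw [Fintype.sum_equiv (Equiv.addLeft s) (fun x => U (s + x)) U fun _ => rfl]
  have hPU : ∀ s, P * U s = P := by
    intro s
    simp only [P]
    rw [smul_mul_assoc, Finset.sum_mul]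
    simp only [hU]
    rw [Fintype.sum_equiv (Equiv.addRight s) (fun x => U (x + s)) U fun _ => rfl]
  have hPs : Pᴴ = P := by
    simp only [P]
    rw [Matrix.conjTranspose_smul, Matrix.conjTranspose_sum]
    simp only [hUs]
    rw [Fintype.sum_equiv (Equiv.neg S) (fun x => U (-x)) U fun _ => rfl]
    simp
  have hPP : P * P = P := by
    conv_lhs => enter [2]; simp only [P]
    rw [mul_smul_comm, Finset.mul_sum]
    simp only [hPU]
    rw [Finset.sum_const, Finset.card_univ, ← Nat.card_eq_fintype_card, ← Nat.cast_smul_eq_nsmul ℂ,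
      smul_smul, inv_mul_cancel₀ hN, one_smul]
  have htr : P.trace = (Fintype.card Y : ℂ) := by
    simp only [P]
    rw [Matrix.trace_smul, Matrix.trace_sum, Finset.sum_eq_single 0]
    · rw [hU0, Matrix.trace_one, smul_eq_mul, inv_mul_eq_iff_eq_mul₀ hN]
      have : Fintype.card (ι → Fin q) = q ^ Fintype.card ι := by simp
      rw [this, ← hY]
      push_cast
      ring
    · intro s _ hs
      simp only [U]
      rw [Matrix.trace_smul, trace_pauli, smul_zero]
      simpa using hs
    · simp
  clear_value P
  obtain ⟨W, hW, hPW⟩ := exists_isometry_of_projector P hPP htr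
  refine ⟨W, hW, ?_⟩
  rintro u ⟨s, hs, hsu⟩
  -- choose a multiple of `s` whose operator does not commute with that of `u`
  obtain ⟨y, hy⟩ := w.χ_ne
  set h := ∑ i, s i * σ (u i) with hh
  obtain ⟨t, ht⟩ : ∃ t : S, w.χ (∑ i, (t : ι → F) i * σ (u i) -
      σ (∑ i, (t : ι → F) i * σ (u i))) ≠ 1 := by
    refine ⟨⟨(y / h) • s, S.smul_mem _ hs⟩, ?_⟩
    have : ∑ i, ((y / h) • s) i * σ (u i) = y := by
      simp only [Pi.smul_apply, smul_eq_mul, mul_assoc]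
      rw [← Finset.mul_sum, ← hh, div_mul_cancel₀ _ hsu]
    simp only [this]
    exact hy
  set c := w.χ (∑ i, (t : ι → F) i * σ (u i) - σ (∑ i, (t : ι → F) i * σ (u i))) with hc
  have hcom : U t * w.pauli u = c • (w.pauli u * U t) := by
    simp only [U]
    rw [smul_mul_assoc, pauli_mul, mul_smul_comm, pauli_mul, cocycle_comm, ← hc, add_comm u]
    simp only [smul_smul]
    congr 1
    ring
  have hPEP : P * w.pauli u * P = c • (P * w.pauli u * P) := by
    calc P * w.pauli u * P = P * (U t * w.pauli u) * P := by
          rw [← mul_assoc, hPU]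
      _ = c • (P * w.pauli u * P) := by
          rw [hcom, Matrix.mul_smul, Matrix.smul_mul, mul_assoc P, mul_assoc (w.pauli u), hUP,
            ← mul_assoc]
  have hzero : P * w.pauli u * P = 0 := by
    have h1 : (1 - c) • (P * w.pauli u * P) = 0 := by
      rw [sub_smul, one_smul, ← hPEP, sub_self]
    exact (smul_eq_zero.1 h1).resolve_left (sub_ne_zero.2 ht.symm)
  have hWP : Wᴴ * P = Wᴴ := by
    rw [← hPs, ← Matrix.conjTranspose_mul, hPW]
  calc Wᴴ * w.pauli u * W = Wᴴ * (P * w.pauli u * P) * W := by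
        rw [← Matrix.mul_assoc, ← Matrix.mul_assoc, hWP, Matrix.mul_assoc _ P, hPW]
    _ = 0 := by rw [hzero]; simp

/-- If no nonzero label supported on `A` is orthogonal to `S`, all product operators supported
on `A` look like scalars on the stabilizer code of `S`. -/
theorem exists_isometry_detecting (w : WeylSystem F σ q) {S : Submodule F (ι → F)}
    (hS : ∀ s ∈ S, ∀ t ∈ S, ∑ i, s i * σ (t i) = 0) (hq : q ≠ 0) {Y : Type*} [Fintype Y]
    [DecidableEq Y] (hY : Fintype.card Y * Nat.card S = q ^ Fintype.card ι) :
    ∃ W : Matrix (ι → Fin q) Y ℂ, Wᴴ * W = 1 ∧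
      ∀ A : Set ι, (∀ u : ι → F, (∀ i ∉ A, u i = 0) → (∀ s ∈ S, ∑ i, s i * σ (u i) = 0) →
        u = 0) →
      ∀ M : ι → Matrix (Fin q) (Fin q) ℂ, (∀ i ∉ A, M i = 1) →
        Wᴴ * tensor M * W = (∏ i, (M i).trace / q) • (1 : Matrix Y Y ℂ) := by
  classical
  obtain ⟨W, hW, hWu⟩ := w.exists_stabilizer_isometry hS hq hY
  refine ⟨W, hW, fun A hA M hM => ?_⟩
  have hdec : ∀ i, ∃ c : F → ℂ, M i = ∑ u, c u • w.T u ∧ c 0 = (M i).trace / q ∧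
      (i ∉ A → ∀ u, u ≠ 0 → c u = 0) := by
    intro i
    by_cases hi : i ∈ A
    · obtain ⟨c, h1, h2⟩ := w.span (M i)
      exact ⟨c, h1, h2, fun h => absurd hi h⟩
    · have hq' : (q : ℂ) ≠ 0 := by exact_mod_cast hq
      refine ⟨Pi.single 0 1, ?_, ?_, ?_⟩
      · rw [hM i hi, Finset.sum_eq_single 0]
        · simp [w.T_zero]
        · intro u _ hu
          simp [Pi.single_eq_of_ne hu]
        · simp
      · rw [hM i hi]
        simp [hq']
      · intro _ u hu
        simp [Pi.single_eq_of_ne hu]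
  choose c hc hc0 hcA using hdec
  have hMt : tensor M = ∑ u : ι → F, (∏ i, c i (u i)) • w.pauli u := by
    have h := tensor_sum c w.T
    rw [← funext hc] at h
    exact h
  rw [hMt, Matrix.mul_sum, Matrix.sum_mul, Finset.sum_eq_single 0]
  · rw [pauli_zero]
    simp only [Pi.zero_apply, hc0]
    rw [Matrix.mul_smul, Matrix.smul_mul, Matrix.mul_one, hW]
  · intro u _ hu
    rw [Matrix.mul_smul, Matrix.smul_mul]
    by_cases hsupp : ∀ i ∉ A, u i = 0
    · have : ∃ s ∈ S, ∑ i, s i * σ (u i) ≠ 0 := by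
        by_contra! h
        exact hu (hA u hsupp h)
      rw [hWu u this, smul_zero]
    · push Not at hsupp
      obtain ⟨i, hi, hui⟩ := hsupp
      rw [Finset.prod_eq_zero (Finset.mem_univ i) (hcA i hi _ hui), zero_smul]
  · simp

end WeylSystem

section Cyclic

open Polynomial

variable {F : Type*} [Field F] {n : ℕ}

theorem coeff_codePoly (c : Fin n → F) (j : ℕ) :
    (codePoly c).coeff j = if h : j < n then c ⟨j, h⟩ else 0 := by
  simp only [codePoly, finsetSum_coeff, coeff_monomial]
  split_ifs with h
  · rw [Finset.sum_eq_single ⟨j, h⟩]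
    · simp
    · intro i _ hi
      rw [if_neg]
      rintro rfl
      exact hi rfl
    · simp
  · refine Finset.sum_eq_zero fun i _ => if_neg ?_
    rintro rfl
    exact h i.2

theorem codePoly_mem_degreeLT (c : Fin n → F) : codePoly c ∈ degreeLT F n := by
  rw [mem_degreeLT, degree_lt_iff_coeff_zero]
  intro m hm
  rw [coeff_codePoly, dif_neg (not_lt.2 hm)]

/-- Coefficients of the remainder modulo `X ^ n - 1`, as a linear map. -/
noncomputable def wordMod (F : Type*) [Field F] (n : ℕ) : F[X] →ₗ[F] Fin n → F where
  toFun p j := (p %ₘ (X ^ n - 1)).coeff j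
  map_add' p r := by
    ext j
    simp [add_modByMonic]
  map_smul' a p := by
    ext j
    simp [smul_modByMonic]

theorem monic_X_pow_sub_one [NeZero n] : (X ^ n - 1 : F[X]).Monic :=
  monic_X_pow_sub_C 1 (NeZero.ne n)

theorem degree_X_pow_sub_one [NeZero n] : (X ^ n - 1 : F[X]).degree = n :=
  degree_X_pow_sub_C (NeZero.pos n) 1

theorem codePoly_wordMod [NeZero n] (p : F[X]) :
    codePoly (wordMod F n p) = p %ₘ (X ^ n - 1) := by
  ext j
  rw [coeff_codePoly]
  split_ifs with h
  · rfl
  · symm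
    apply coeff_eq_zero_of_degree_lt
    refine (degree_modByMonic_lt p monic_X_pow_sub_one).trans_le ?_
    rw [degree_X_pow_sub_one]
    exact_mod_cast not_lt.1 h

theorem wordMod_codePoly [NeZero n] (c : Fin n → F) : wordMod F n (codePoly c) = c := by
  ext j
  have h : codePoly c %ₘ (X ^ n - 1) = codePoly c := by
    rw [modByMonic_eq_self_iff monic_X_pow_sub_one, degree_X_pow_sub_one]
    exact mem_degreeLT.1 (codePoly_mem_degreeLT c)
  change (codePoly c %ₘ (X ^ n - 1)).coeff j = c j
  rw [h, coeff_codePoly, dif_pos j.2]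

theorem wordMod_eq_of_dvd [NeZero n] {p r : F[X]} (h : X ^ n - 1 ∣ p - r) :
    wordMod F n p = wordMod F n r := by
  rw [← sub_eq_zero, ← map_sub]
  ext j
  change ((p - r) %ₘ (X ^ n - 1)).coeff j = 0
  rw [(modByMonic_eq_zero_iff_dvd monic_X_pow_sub_one).2 h, coeff_zero]

/-- Multiplication by `X` is the cyclic shift. -/
theorem wordMod_X_mul [NeZero n] (p : F[X]) :
    wordMod F n (X * p) = fun i => wordMod F n p (i - 1) := by
  set c := wordMod F n p with hc
  have h1 : wordMod F n (X * p) = wordMod F n (X * codePoly c) := by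
    apply wordMod_eq_of_dvd
    rw [← mul_sub, hc, codePoly_wordMod]
    refine Dvd.dvd.mul_left ?_ X
    exact ⟨p /ₘ (X ^ n - 1), by
      linear_combination -(modByMonic_add_div p (X ^ n - 1 : F[X]))⟩
  rw [h1]
  have h2 : wordMod F n (X * codePoly c) = wordMod F n (codePoly fun i => c (i - 1)) := by
    apply wordMod_eq_of_dvd
    obtain ⟨m, rfl⟩ : ∃ m, n = m + 1 := ⟨n - 1, (Nat.succ_pred (NeZero.ne n)).symm⟩
    refine ⟨C (c (Fin.last m)), ?_⟩
    simp only [codePoly, ← C_mul_X_pow_eq_monomial]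
    rw [Fin.sum_univ_castSucc, Fin.sum_univ_succ (fun i : Fin (m + 1) => C (c (i - 1)) * _)]
    have h0 : (0 - 1 : Fin (m + 1)) = Fin.last m := by
      rw [sub_eq_iff_eq_add, Fin.last_add_one]
    have hs : ∀ i : Fin m, (i.succ - 1 : Fin (m + 1)) = i.castSucc := by
      intro i
      rw [← Fin.coeSucc_eq_succ, add_sub_cancel_right]
    simp only [h0, hs, Fin.val_zero, pow_zero, Fin.val_succ, Fin.val_castSucc, Fin.val_last,
      pow_succ, mul_add, Finset.mul_sum]
    have : ∀ i : Fin m, (X : F[X]) * (C (c i.castSucc) * X ^ (i : ℕ)) =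
        C (c i.castSucc) * (X ^ (i : ℕ) * X) := fun i => by ring
    simp only [this]
    ring
  rw [h2, wordMod_codePoly]

/-- A cyclic code consists of the multiples of a divisor of `X ^ n - 1`. -/
theorem IsCyclicCode.exists_generator [NeZero n] {C : Submodule F (Fin n → F)}
    (hC : IsCyclicCode C) :
    ∃ g : F[X], g ∣ X ^ n - 1 ∧ (∀ c, c ∈ C ↔ g ∣ codePoly c) ∧
      g ∈ Ideal.span ({X ^ n - 1} ∪ codePoly '' (C : Set (Fin n → F))) := by
  set J : Ideal F[X] := Ideal.span ({X ^ n - 1} ∪ codePoly '' (C : Set (Fin n → F))) with hJ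
  obtain ⟨g, hg⟩ := (IsPrincipalIdealRing.principal J).principal
  have hmem : ∀ p, p ∈ J ↔ g ∣ p := fun p => by
    rw [hg]
    exact Ideal.mem_span_singleton
  let J' : Ideal F[X] :=
    { carrier := {p | wordMod F n p ∈ C}
      zero_mem' := by simp
      add_mem' := fun {a b} ha hb => by
        simp only [Set.mem_ofPred_eq, map_add] at *
        exact C.add_mem ha hb
      smul_mem' := fun a p hp => by
        simp only [Set.mem_ofPred_eq, smul_eq_mul] at *
        induction a using Polynomial.induction_on' with
        | add a b ha hb =>
          rw [add_mul, map_add]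
          exact C.add_mem ha hb
        | monomial m r =>
          rw [← C_mul_X_pow_eq_monomial, mul_assoc, ← smul_eq_C_mul, map_smul]
          refine C.smul_mem _ ?_
          induction m with
          | zero => simpa using hp
          | succ m ih =>
            rw [pow_succ', mul_assoc, wordMod_X_mul]
            exact hC _ ih }
  have hJJ : J ≤ J' := by
    rw [hJ, Ideal.span_le]
    rintro p (rfl | ⟨c, hc, rfl⟩)
    · change wordMod F n _ ∈ C
      rw [wordMod_eq_of_dvd (r := 0) (by simp), map_zero]
      exact C.zero_mem
    · change wordMod F n _ ∈ C
      rwa [wordMod_codePoly]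
  refine ⟨g, (hmem _).1 (Ideal.subset_span (Or.inl rfl)), fun c => ⟨fun hc =>
    (hmem _).1 (Ideal.subset_span (Or.inr ⟨c, hc, rfl⟩)), fun hc => ?_⟩, (hmem g).2 dvd_rfl⟩
  have h : wordMod F n (codePoly c) ∈ C := hJJ ((hmem _).2 hc)
  rwa [wordMod_codePoly] at h

/-- The polynomials of degree less than `n` divisible by a divisor of `X ^ n - 1`. -/
theorem finrank_add_natDegree [NeZero n] {C : Submodule F (Fin n → F)} {g : F[X]}
    (hg : g ∣ X ^ n - 1) (hC : ∀ c, c ∈ C ↔ g ∣ codePoly c) :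
    Module.finrank F C + g.natDegree = n := by
  have hX : (X ^ n - 1 : F[X]) ≠ 0 := monic_X_pow_sub_one.ne_zero
  have hg0 : g ≠ 0 := ne_zero_of_dvd_ne_zero hX hg
  have hgn : g.natDegree ≤ n := by
    have h := natDegree_le_of_dvd hg hX
    rwa [natDegree_eq_of_degree_eq_some degree_X_pow_sub_one] at h
  set m := n - g.natDegree with hm
  have hgm : m + g.natDegree = n := Nat.sub_add_cancel hgn
  -- multiplication by `g`
  let φ : degreeLT F m →ₗ[F] Fin n → F :=
    wordMod F n ∘ₗ LinearMap.mulLeft F g ∘ₗ (degreeLT F m).subtype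
  have hdeg : ∀ p ∈ degreeLT F m, (g * p).degree < n := by
    intro p hp
    rw [mem_degreeLT] at hp
    by_cases hp0 : p = 0
    · simp [hp0]
    · rw [degree_eq_natDegree (mul_ne_zero hg0 hp0), natDegree_mul hg0 hp0]
      rw [degree_eq_natDegree hp0] at hp
      have : p.natDegree < m := by exact_mod_cast hp
      have : g.natDegree + p.natDegree < n := by omega
      exact_mod_cast this
  have hφ : ∀ p : degreeLT F m, codePoly (φ p) = g * p := by
    intro p
    change codePoly (wordMod F n (g * p)) = g * p
    rw [codePoly_wordMod, modByMonic_eq_self_iff monic_X_pow_sub_one, degree_X_pow_sub_one]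
    exact hdeg p p.2
  have hinj : Function.Injective φ := by
    intro p r h
    have := hφ p
    rw [h, hφ r] at this
    exact Subtype.ext (mul_left_cancel₀ hg0 this).symm
  have hrange : LinearMap.range φ = C := by
    ext c
    rw [hC]
    constructor
    · rintro ⟨p, rfl⟩
      rw [hφ]
      exact dvd_mul_right _ _
    · rintro ⟨p, hp⟩
      have hp' : p ∈ degreeLT F m := by
        rw [mem_degreeLT]
        by_cases hp0 : p = 0
        · simp [hp0]
        · have h := mem_degreeLT.1 (codePoly_mem_degreeLT c)
          rw [hp, degree_eq_natDegree (mul_ne_zero hg0 hp0), natDegree_mul hg0 hp0] at h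
          rw [degree_eq_natDegree hp0]
          have : g.natDegree + p.natDegree < n := by exact_mod_cast h
          have : p.natDegree < m := by omega
          exact_mod_cast this
      refine ⟨⟨p, hp'⟩, ?_⟩
      rw [← wordMod_codePoly (φ _), hφ, ← wordMod_codePoly c, hp]
  have h := LinearMap.finrank_range_of_inj hinj
  rw [hrange, (degreeLTEquiv F m).finrank_eq, Module.finrank_fin_fun] at h
  rw [h, hgm]

theorem finrank_add_ncard_definingSet [NeZero n] {L : Type*} [Field L] [Algebra F L] {α : L}
    (hα : IsPrimitiveRoot α n) {C : Submodule F (Fin n → F)} (hC : IsCyclicCode C) :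
    Module.finrank F C + (definingSet α C).ncard = n := by
  classical
  obtain ⟨g, hgX, hgC, hgJ⟩ := hC.exists_generator
  have hX : (X ^ n - 1 : F[X]) ≠ 0 := monic_X_pow_sub_one.ne_zero
  have hg0 : g ≠ 0 := ne_zero_of_dvd_ne_zero hX hgX
  refine Eq.trans (congrArg _ ?_) (finrank_add_natDegree hgX hgC)
  have hpow : ∀ i : ℕ, (α ^ i) ^ n = 1 := fun i => by
    rw [← pow_mul, mul_comm, pow_mul, hα.pow_eq_one, one_pow]
  have hZ : ∀ i : Fin n, i ∈ definingSet α C ↔ aeval (α ^ (i : ℕ)) g = 0 := by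
    intro i
    constructor
    · intro hi
      have hle : Ideal.span ({X ^ n - 1} ∪ codePoly '' (C : Set (Fin n → F))) ≤
          RingHom.ker (aeval (R := F) (α ^ (i : ℕ))) := by
        rw [Ideal.span_le]
        rintro p (rfl | ⟨c, hc, rfl⟩)
        · change aeval (α ^ (i : ℕ)) (X ^ n - 1) = 0
          simp [hpow]
        · exact hi c hc
      exact hle hgJ
    · intro hi c hc
      obtain ⟨p, hp⟩ := (hgC c).1 hc
      rw [hp, map_mul, hi, zero_mul]
  set G := g.map (algebraMap F L) with hG
  have hGX : G ∣ X ^ n - Polynomial.C 1 := by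
    have h := Polynomial.map_dvd (algebraMap F L) hgX
    simpa using h
  have hXL : (X ^ n - Polynomial.C 1 : L[X]) ≠ 0 := X_pow_sub_C_ne_zero (NeZero.pos n) 1
  have hG0 : G ≠ 0 := ne_zero_of_dvd_ne_zero hXL hGX
  have hsplit : (X ^ n - Polynomial.C 1 : L[X]).Splits := by
    have := X_pow_sub_one_splits hα
    simpa using this
  have hGs : G.Splits := Splits.of_dvd hsplit hXL hGX
  have hnodup : (X ^ n - Polynomial.C 1 : L[X]).roots.Nodup := hα.nthRoots_one_nodup
  have hGn : G.roots.Nodup := Multiset.nodup_of_le (roots.le_of_dvd hXL hGX) hnodup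
  have hcard : g.natDegree = G.roots.toFinset.card := by
    rw [Multiset.toFinset_card_of_nodup hGn, ← hGs.natDegree_eq_card_roots, hG, natDegree_map]
  rw [hcard, ← Set.ncard_coe_finset]
  refine Set.ncard_congr (fun i _ => α ^ (i : ℕ)) ?_ ?_ ?_
  · intro i hi
    have := (hZ i).1 hi
    simp [hG, this, hg0]
  · intro i j _ _ h
    exact Fin.ext (hα.pow_inj i.2 j.2 h)
  · intro x hx
    have hx' : aeval x g = 0 := by
      have h : g ≠ 0 ∧ aeval x g = 0 := by simpa [hG] using hx
      exact h.2
    have hx1 : x ^ n = 1 := by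
      obtain ⟨p, hp⟩ := hgX
      have := congrArg (aeval x) hp
      rw [map_mul, hx', zero_mul] at this
      simpa [sub_eq_zero] using this
    obtain ⟨i, hi, rfl⟩ := hα.eq_pow_of_pow_eq_one hx1
    exact ⟨⟨i, hi⟩, (hZ _).2 hx', rfl⟩

theorem definingSet_sup {L : Type*} [Field L] [Algebra F L] (α : L)
    (C D : Submodule F (Fin n → F)) :
    definingSet α (C ⊔ D) = definingSet α C ∩ definingSet α D := by
  ext i
  constructor
  · exact fun h => ⟨fun c hc => h c (Submodule.mem_sup_left hc),
      fun c hc => h c (Submodule.mem_sup_right hc)⟩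
  · rintro ⟨h1, h2⟩ c hc
    obtain ⟨a, ha, b, hb, rfl⟩ := Submodule.mem_sup.1 hc
    have : codePoly (a + b) = codePoly a + codePoly b := by
      simp [codePoly, Finset.sum_add_distrib]
    rw [this, map_add, h1 a ha, h2 b hb, add_zero]

theorem IsCyclicCode.sup [NeZero n] {C D : Submodule F (Fin n → F)} (hC : IsCyclicCode C)
    (hD : IsCyclicCode D) : IsCyclicCode (C ⊔ D) := by
  intro c hc
  obtain ⟨a, ha, b, hb, rfl⟩ := Submodule.mem_sup.1 hc
  exact Submodule.mem_sup.2 ⟨_, hC a ha, _, hD b hb, rfl⟩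

theorem IsCyclicCode.hermitianDual [NeZero n] {C : Submodule F (Fin n → F)}
    (hC : IsCyclicCode C) (q : ℕ) : IsCyclicCode (hermitianDual q C) := by
  intro x hx c hc
  -- iterating the shift `n - 1` times gives the inverse shift
  have hshift : ∀ (m : ℕ), (fun i : Fin n => c (i - m • 1)) ∈ C := by
    intro m
    induction m with
    | zero => simpa using hc
    | succ m ih =>
      have := hC _ ih
      simpa only [sub_sub, add_comm (1 : Fin n), succ_nsmul] using this
  have h1 : (fun i : Fin n => c (i + 1)) ∈ C := by
    have h := hshift (n - 1)
    have h2 : (n - 1) • (1 : Fin n) = -1 := by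
      rw [eq_neg_iff_add_eq_zero, ← succ_nsmul,
        Nat.sub_add_cancel (NeZero.pos n)]
      have h0 := card_nsmul_eq_zero' (G := Fin n) (x := 1)
      rwa [Nat.card_eq_fintype_card, Fintype.card_fin] at h0
    rw [h2] at h
    simpa only [sub_neg_eq_add] using h
  have h := hx _ h1
  rw [← h]
  refine (Fintype.sum_equiv (Equiv.addRight (1 : Fin n)) _ _ fun i => ?_).symm
  simp

end Cyclic

section Frobenius

variable {F : Type*} [Field F] [Fintype F] {q : ℕ} {σ : F →+* F}

/-- A generator of the multiplicative group, and its order. -/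
theorem exists_generator_orderOf (hF : Fintype.card F = q ^ 2) :
    ∃ g : Fˣ, (∀ a : Fˣ, ∃ m : ℕ, g ^ m = a) ∧ orderOf g = (q - 1) * (q + 1) := by
  classical
  obtain ⟨g, hg⟩ := IsCyclic.exists_monoid_generator (α := Fˣ)
  refine ⟨g, fun a => Submonoid.mem_powers_iff _ _ |>.1 (hg a), ?_⟩
  have h : orderOf g = Fintype.card Fˣ := by
    rw [← Nat.card_eq_fintype_card]
    exact orderOf_eq_card_of_forall_mem_powers hg
  rw [h, Fintype.card_units, hF, mul_comm, ← Nat.sq_sub_sq, one_pow]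

theorem exists_norm_eq (hq : 1 < q) (hF : Fintype.card F = q ^ 2) (hσ : ∀ x, σ x = x ^ q) {a : F}
    (ha : a ≠ 0) (hσa : σ a = a) : ∃ b, b * σ b = a := by
  obtain ⟨g, hg, hord⟩ := exists_generator_orderOf hF
  obtain ⟨m, hm⟩ := hg (Units.mk0 a ha)
  have hm' : (g : F) ^ m = a := by
    rw [← Units.val_pow_eq_pow_val, hm, Units.val_mk0]
  have h1 : g ^ (m * (q - 1)) = 1 := by
    rw [pow_mul, hm]
    ext
    have h2 : a ^ (q - 1) * a = 1 * a := by
      rw [← pow_succ, Nat.sub_add_cancel hq.le, ← hσ, hσa, one_mul]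
    simpa using mul_right_cancel₀ ha h2
  have h2 := orderOf_dvd_of_pow_eq_one h1
  rw [hord, mul_comm] at h2
  obtain ⟨r, rfl⟩ := Nat.dvd_of_mul_dvd_mul_right (by omega) h2
  refine ⟨(g : F) ^ r, ?_⟩
  rw [hσ, ← hm', ← pow_mul, ← pow_add]
  congr 1
  ring

theorem exists_trace_ne_zero (hq : 1 < q) (hF : Fintype.card F = q ^ 2)
    (hσ : ∀ x, σ x = x ^ q) : ∃ y, y + σ y ≠ 0 := by
  obtain ⟨g, -, hord⟩ := exists_generator_orderOf hF
  refine ⟨g, fun h => ?_⟩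
  rw [hσ] at h
  have h1 : (g : F) ^ (q - 1) = -1 := by
    apply mul_right_cancel₀ g.ne_zero
    rw [← pow_succ, Nat.sub_add_cancel hq.le]
    linear_combination h
  have h2 : g ^ ((q - 1) * 2) = 1 := by
    ext
    rw [pow_mul, Units.val_pow_eq_pow_val, Units.val_pow_eq_pow_val, h1]
    simp
  have h3 := orderOf_dvd_of_pow_eq_one h2
  rw [hord] at h3
  have h4 := Nat.le_of_dvd (by norm_num) (Nat.dvd_of_mul_dvd_mul_left (by omega) h3)
  omega

/-- A Hermitian form over a finite field is, up to its radical, minus the standard one. -/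
theorem exists_map_to_standard (hnorm : ∀ a, a ≠ 0 → σ a = a → ∃ b, b * σ b = a)
    (htrace : ∃ y, y + σ y ≠ 0) (m : ℕ)
    {V : Type*} [AddCommGroup V] [Module F V] [Module.Finite F V] (hm : Module.finrank F V = m)
    (B : V → V →ₗ[F] F) (hB : ∀ s t, B t s = σ (B s t)) :
    ∃ (c : ℕ) (φ : V →ₗ[F] Fin c → F), Function.Surjective φ ∧
      ∀ s t, ∑ j, φ s j * σ (φ t j) = -B t s := by
  induction m using Nat.strong_induction_on generalizing V with
  | _ m ih =>
  by_cases h0 : ∀ s t, B t s = 0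
  · exact ⟨0, 0, fun x => ⟨0, Subsingleton.elim _ _⟩, fun s t => by simp [h0]⟩
  have haddl : ∀ s t r, B (s + t) r = B s r + B t r := fun s t r => by
    rw [hB, map_add, map_add, ← hB, ← hB]
  have hsmull : ∀ (a : F) t r, B (a • t) r = σ a * B t r := fun a t r => by
    rw [hB, map_smul, smul_eq_mul, map_mul, ← hB]
  -- an anisotropic vector
  obtain ⟨v, hv⟩ : ∃ v, B v v ≠ 0 := by
    by_contra! hall
    push Not at h0
    obtain ⟨s, t, hst⟩ := h0
    obtain ⟨y, hy⟩ := htrace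
    have h1 := hall ((y / B t s) • s + t)
    rw [haddl, map_add, map_add, hall, hall, hsmull, map_smul, smul_eq_mul,
      div_mul_cancel₀ _ hst, hB t s, ← map_mul, div_mul_cancel₀ _ hst] at h1
    exact hy (by linear_combination h1)
  obtain ⟨v, hv⟩ : ∃ v, B v v = -1 := by
    obtain ⟨b, hb⟩ := hnorm (-(B v v)⁻¹) (by simpa using hv) (by
      rw [map_neg, map_inv₀, ← hB])
    refine ⟨b • v, ?_⟩
    rw [hsmull, map_smul, smul_eq_mul, ← mul_assoc, mul_comm (σ b), hb]
    field_simp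
  let D := LinearMap.ker (B v)
  have hD : Module.finrank F D < m := by
    rw [← hm]
    apply Submodule.finrank_lt
    intro h
    have : v ∈ D := h ▸ Submodule.mem_top
    rw [LinearMap.mem_ker, hv] at this
    simp at this
  obtain ⟨c, φ, hφ, hφB⟩ := ih _ hD (V := D) rfl (fun t => (B t).domRestrict D)
    (fun s t => hB _ _)
  have hp : ∀ s, s + B v s • v ∈ D := fun s => by
    rw [LinearMap.mem_ker, map_add, map_smul, hv]
    simp
  let p : V →ₗ[F] D := LinearMap.codRestrict D (LinearMap.id + (B v).smulRight v) hp
  have hpv : ∀ s, (p s : V) = s + B v s • v := fun s => rfl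
  refine ⟨c + 1, LinearMap.pi (Fin.cons (B v) fun j => LinearMap.proj j ∘ₗ φ ∘ₗ p), ?_, ?_⟩
  · intro x
    obtain ⟨s, hs⟩ := hφ (fun j => x j.succ)
    have hs0 : B v s = 0 := s.2
    have h1 : B v ((s : V) - x 0 • v) = x 0 := by
      rw [map_sub, map_smul, hs0, hv]
      simp
    have h2 : p ((s : V) - x 0 • v) = s := by
      apply Subtype.ext
      rw [hpv, h1, sub_add_cancel]
    refine ⟨(s : V) - x 0 • v, ?_⟩
    ext j
    refine Fin.cases ?_ (fun j => ?_) j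
    · simpa using h1
    · simp [h2, hs]
  · intro s t
    rw [Fin.sum_univ_succ]
    simp only [LinearMap.pi_apply, Fin.cons_zero, Fin.cons_succ, LinearMap.comp_apply,
      LinearMap.proj_apply]
    rw [hφB]
    simp only [LinearMap.domRestrict_apply, hpv]
    rw [haddl, hsmull, map_add, map_add, map_smul, map_smul, hv, hB v t]
    simp only [smul_eq_mul]
    ring

end Frobenius

section HermitianDual

variable {F : Type*} [Field F] [Fintype F] {q n : ℕ} {σ : F →+* F}

theorem mem_hermitianDual (hσ : ∀ x, σ x = x ^ q) {C : Submodule F (Fin n → F)} {x : Fin n → F} :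
    x ∈ hermitianDual q C ↔ ∀ c ∈ C, ∑ i, x i * σ (c i) = 0 := by
  simp only [hσ]
  rfl

/-- The coordinatewise conjugate of a code. -/
def conjCode (σ : F →+* F) (C : Submodule F (Fin n → F)) :
    Submodule F (Fin n → F) where
  carrier := {x | (fun i => σ (x i)) ∈ C}
  zero_mem' := by
    simp only [Set.mem_ofPred_eq, Pi.zero_apply, map_zero]
    exact C.zero_mem
  add_mem' := by
    intro x y hx hy
    simp only [Set.mem_ofPred_eq, Pi.add_apply, map_add] at *
    exact C.add_mem hx hy
  smul_mem' := by
    intro a x hx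
    simp only [Set.mem_ofPred_eq, Pi.smul_apply, smul_eq_mul, map_mul] at *
    exact C.smul_mem (σ a) hx

theorem finrank_conjCode (hσσ : ∀ x, σ (σ x) = x) (C : Submodule F (Fin n → F)) :
    Module.finrank F (conjCode σ C) = Module.finrank F C := by
  classical
  let e : conjCode σ C ≃ C :=
    { toFun := fun x => ⟨fun i => σ (x.1 i), x.2⟩
      invFun := fun x => ⟨fun i => σ (x.1 i), by
        change (fun i => σ (σ (x.1 i))) ∈ C
        simp only [hσσ]
        exact x.2⟩
      left_inv := fun x => by
        ext i
        exact hσσ _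
      right_inv := fun x => by
        ext i
        exact hσσ _ }
  have h := Fintype.card_congr e
  rw [Module.card_eq_pow_finrank (K := F), Module.card_eq_pow_finrank (K := F) (V := C)] at h
  exact Nat.pow_right_injective (Fintype.one_lt_card (α := F)) h

theorem finrank_hermitianDual (hσ : ∀ x, σ x = x ^ q) (hσσ : ∀ x, σ (σ x) = x)
    (C : Submodule F (Fin n → F)) :
    Module.finrank F (hermitianDual q C) + Module.finrank F C = n := by
  classical
  let B : LinearMap.BilinForm F (Fin n → F) := Matrix.toBilin' (1 : Matrix (Fin n) (Fin n) F)
  have hB : ∀ x y, B x y = ∑ i, x i * y i := fun x y => by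
    simp [B, Matrix.toBilin'_apply', dotProduct]
  have hnd : B.Nondegenerate := by
    apply LinearMap.BilinForm.nondegenerate_toBilin'_of_det_ne_zero'
    simp
  have horth : B.orthogonal (conjCode σ C) = hermitianDual q C := by
    ext x
    rw [mem_hermitianDual hσ, LinearMap.BilinForm.mem_orthogonal_iff]
    constructor
    · intro h c hc
      have h1 := h (fun i => σ (c i)) (by
        change (fun i => σ (σ (c i))) ∈ C
        simp only [hσσ]
        exact hc)
      rw [hB] at h1
      simpa [mul_comm] using h1
    · intro h c hc
      have h1 := h _ hc
      rw [hB]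
      simpa [mul_comm, hσσ] using h1
  have h := LinearMap.BilinForm.finrank_orthogonal hnd (conjCode σ C)
  rw [horth, finrank_conjCode hσσ, Module.finrank_fin_fun] at h
  have h2 := C.finrank_le
  rw [Module.finrank_fin_fun] at h2
  omega

theorem hermitianDual_hermitianDual (hσ : ∀ x, σ x = x ^ q) (hσσ : ∀ x, σ (σ x) = x)
    (C : Submodule F (Fin n → F)) : hermitianDual q (hermitianDual q C) = C := by
  symm
  apply Submodule.eq_of_le_of_finrank_eq
  · intro c hc
    rw [mem_hermitianDual hσ]
    intro x hx
    have h := congrArg σ ((mem_hermitianDual hσ).1 hx c hc)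
    simpa [map_sum, hσσ, mul_comm] using h
  · have h1 := finrank_hermitianDual hσ hσσ C
    have h2 := finrank_hermitianDual hσ hσσ (hermitianDual q C)
    omega

end HermitianDual

/-- An operator on the positions in `S` is a combination of product operators. -/
theorem ActsOn.eq_sum {q n : ℕ} {S : Finset (Fin n)} {E : Matrix (Labels q n) (Labels q n) ℂ}
    (hE : ActsOn S E) :
    ∃ M : Matrix (S → Fin q) (S → Fin q) ℂ, E = ∑ a, ∑ b, M a b • tensor fun i =>
      if h : i ∈ S then Matrix.single (a ⟨i, h⟩) (b ⟨i, h⟩) (1 : ℂ) else 1 := by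
  obtain ⟨M, hM⟩ := hE
  refine ⟨M, ?_⟩
  ext y z
  have hentry : ∀ a b : S → Fin q, tensor (fun i : Fin n =>
      if h : i ∈ S then Matrix.single (a ⟨i, h⟩) (b ⟨i, h⟩) (1 : ℂ) else 1) y z =
      if (∀ i, i ∉ S → y i = z i) ∧ a = (fun i : S => y i) ∧ b = (fun i : S => z i) then 1
        else 0 := by
    intro a b
    have h1 : ∀ i, (if h : i ∈ S then Matrix.single (a ⟨i, h⟩) (b ⟨i, h⟩) (1 : ℂ) else 1)
        (y i) (z i) =
        if (∀ h : i ∈ S, a ⟨i, h⟩ = y i ∧ b ⟨i, h⟩ = z i) ∧ (i ∉ S → y i = z i) then 1 else 0 := by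
      intro i
      by_cases h : i ∈ S
      · simp [h, Matrix.single_apply]
      · simp [h, Matrix.one_apply]
    simp only [tensor, Matrix.of_apply, h1]
    rw [Fintype.prod_ite_zero]
    simp only [Finset.prod_const_one]
    refine if_congr ⟨fun h => ⟨fun i hi => (h i).2 hi, ?_, ?_⟩, ?_⟩ rfl rfl
    · ext i
      rw [((h i).1 i.2).1]
    · ext i
      rw [((h i).1 i.2).2]
    · rintro ⟨h, rfl, rfl⟩ i
      exact ⟨fun _ => ⟨rfl, rfl⟩, h i⟩
  simp only [Matrix.sum_apply, Matrix.smul_apply, hentry, hM, smul_eq_mul]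
  rw [Finset.sum_eq_single fun i : S => y i]
  · rw [Finset.sum_eq_single fun i : S => z i]
    · simp
    · intro b _ hb
      simp [hb]
    · simp
  · intro a _ ha
    simp [ha]
  · simp

/-- Reading the labels of `n + c` qudits as pairs. -/
theorem tensor_sumElim_one {q n c : ℕ} (M : Fin n → Matrix (Fin q) (Fin q) ℂ)
    (y z : Labels q n) (a b : Labels q c) :
    tensor (Sum.elim M fun _ : Fin c => 1) (Sum.elim y a) (Sum.elim z b) =
      (tensor M ⊗ₖ (1 : Matrix (Labels q c) (Labels q c) ℂ)) (y, a) (z, b) := by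
  rw [← tensor_one (ι := Fin c) (q := q)]
  simp only [tensor, Matrix.of_apply, Matrix.kroneckerMap_apply]
  rw [Fintype.prod_sum_type]
  rfl

theorem tensor_sumElim_single {q n c : ℕ} (a b a' b' : Labels q c) (y z : Labels q n) :
    tensor (Sum.elim (fun _ : Fin n => 1) fun j : Fin c => Matrix.single (a j) (b j) (1 : ℂ))
      (Sum.elim y a') (Sum.elim z b') = if y = z ∧ a = a' ∧ b = b' then 1 else 0 := by
  have h1 : (∏ i, (1 : Matrix (Fin q) (Fin q) ℂ) (y i) (z i)) = if y = z then 1 else 0 := by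
    simp only [Matrix.one_apply]
    rw [Fintype.prod_ite_zero]
    simp [funext_iff]
  have h2 : (∏ j, (Matrix.single (a j) (b j) (1 : ℂ)) (a' j) (b' j)) =
      if a = a' ∧ b = b' then 1 else 0 := by
    simp only [Matrix.single_apply]
    rw [Fintype.prod_ite_zero]
    simp [funext_iff, forall_and]
  simp only [tensor, Matrix.of_apply]
  rw [Fintype.prod_sum_type]
  refine Eq.trans (congrArg₂ (· * ·) h1 h2) ?_
  by_cases hy : y = z <;> simp [hy]

/-- An isometry on `n + c` qudits that looks like a scalar multiple of an isometry to product
operators supported on fewer than `d` of the first `n` qudits, and to all product operators on the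
last `c`, gives an entanglement-assisted code. -/
theorem existsCode_of_isometry {q n K d c : ℕ} (hq : q ≠ 0)
    (W : Matrix (Fin n ⊕ Fin c → Fin q) (Labels q K) ℂ)
    (h1 : ∀ S : Finset (Fin n), S.card < d → ∀ M : Fin n → Matrix (Fin q) (Fin q) ℂ,
      (∀ i ∉ S, M i = 1) → Wᴴ * tensor (Sum.elim M fun _ : Fin c => (1 : Matrix (Fin q) (Fin q) ℂ)) * W =
        (∏ i, (M i).trace / q) • (1 : Matrix (Labels q K) (Labels q K) ℂ))
    (h2 : ∀ M : Fin c → Matrix (Fin q) (Fin q) ℂ, Wᴴ * tensor (Sum.elim (fun _ : Fin n => (1 : Matrix (Fin q) (Fin q) ℂ)) M) * W =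
        (∏ i, (M i).trace / q) • (1 : Matrix (Labels q K) (Labels q K) ℂ)) :
    ExistsCode q n K d c := by
  classical
  have hq' : (0 : ℝ) < (q : ℝ) ^ c := by positivity
  set r : ℝ := Real.sqrt ((q : ℝ) ^ c) with hr
  have hr0 : r ≠ 0 := (Real.sqrt_pos.2 hq').ne'
  have hrr : (r : ℂ) * r = (q : ℂ) ^ c := by
    rw [← Complex.ofReal_mul, hr, Real.mul_self_sqrt hq'.le]
    push_cast
    rfl
  let e : Labels q n × Labels q c ≃ (Fin n ⊕ Fin c → Fin q) :=
    (Equiv.sumArrowEquivProdArrow _ _ _).symm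
  have he : ∀ y a, e (y, a) = Sum.elim y a := fun y a => rfl
  let V : Matrix (Labels q n) (Labels q K × Labels q c) ℂ :=
    Matrix.of fun y xa => (r : ℂ) * W (Sum.elim y xa.2) xa.1
  have henc : encodingMatrix V = W.submatrix e id := by
    ext ⟨y, b⟩ x
    simp only [encodingMatrix, Matrix.of_apply, maxEntangled, V, ← hr, Matrix.submatrix_apply, he,
      id]
    rw [Finset.sum_eq_single b]
    · have : (r : ℂ) ≠ 0 := by exact_mod_cast hr0
      simp only [if_true]
      push_cast
      field_simp
    · intro a _ ha
      simp [ha]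
    · simp
  refine ⟨V, ?_, ?_⟩
  · ext ⟨x, a⟩ ⟨x', a'⟩
    have h := congrFun (congrFun (h2 fun j => Matrix.single (a j) (a' j) (1 : ℂ)) x) x'
    have hL : (Wᴴ * tensor (Sum.elim (fun _ : Fin n => (1 : Matrix (Fin q) (Fin q) ℂ))
        fun j => Matrix.single (a j) (a' j) (1 : ℂ)) * W) x x' =
        ∑ y : Labels q n, star (W (Sum.elim y a) x) * W (Sum.elim y a') x' := by
      simp only [Matrix.mul_apply, Matrix.conjTranspose_apply, Finset.sum_mul]
      rw [← e.sum_comp]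
      simp only [← e.sum_comp (fun z => star (W z x) * _ * _), Fintype.sum_prod_type, he,
        tensor_sumElim_single]
      simp only [ite_and, mul_ite, mul_one, mul_zero, ite_mul, zero_mul]
      simp [Finset.sum_ite_eq, Finset.sum_ite_eq']
    rw [hL] at h
    have hprod : (∏ j, (Matrix.single (a j) (a' j) (1 : ℂ)).trace / (q : ℂ)) =
        if a = a' then ((q : ℂ) ^ c)⁻¹ else 0 := by
      have : ∀ j, (Matrix.single (a j) (a' j) (1 : ℂ)).trace / (q : ℂ) =
          if a j = a' j then (q : ℂ)⁻¹ else 0 := by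
        intro j
        split_ifs with hj
        · rw [hj, Matrix.trace_single_eq_same, one_div]
        · rw [Matrix.trace_single_eq_of_ne _ _ _ hj, zero_div]
      simp only [this]
      rw [Fintype.prod_ite_zero]
      simp [funext_iff]
    rw [hprod] at h
    have hqc : (q : ℂ) ^ c ≠ 0 := pow_ne_zero _ (by exact_mod_cast hq)
    have hV : (Vᴴ * V) (x, a) (x', a') =
        (r : ℂ) * r * ∑ y : Labels q n, star (W (Sum.elim y a) x) * W (Sum.elim y a') x' := by
      simp only [Matrix.mul_apply, Matrix.conjTranspose_apply, V, Matrix.of_apply,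
        Finset.mul_sum]
      refine Finset.sum_congr rfl fun y _ => ?_
      simp only [star_mul', Complex.star_def, Complex.conj_ofReal]
      ring
    rw [hV, h, hrr, Matrix.smul_apply, Matrix.one_apply, Matrix.one_apply]
    simp only [Prod.mk.injEq]
    by_cases hx : x = x' <;> by_cases ha : a = a' <;> simp [hx, ha, hqc]
  · intro S hS E hE
    set U := encodingMatrix V with hU
    have hdetect : ∀ N : Fin n → Matrix (Fin q) (Fin q) ℂ, (∀ i ∉ S, N i = 1) →
        Uᴴ * (tensor N ⊗ₖ (1 : Matrix (Labels q c) (Labels q c) ℂ)) * U =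
          ((tensor N).trace / (q : ℂ) ^ n) • (1 : Matrix (Labels q K) (Labels q K) ℂ) := by
      intro N hN
      have hs : tensor N ⊗ₖ (1 : Matrix (Labels q c) (Labels q c) ℂ) =
          (tensor (Sum.elim N fun _ : Fin c => (1 : Matrix (Fin q) (Fin q) ℂ))).submatrix e e := by
        ext ⟨y, a⟩ ⟨z, b⟩
        rw [Matrix.submatrix_apply, he, he, tensor_sumElim_one]
      rw [hs, henc, Matrix.conjTranspose_submatrix, Matrix.submatrix_mul_equiv,
        Matrix.submatrix_mul_equiv, Matrix.submatrix_id_id, h1 S hS N hN, trace_tensor,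
        Finset.prod_div_distrib]
      simp
    obtain ⟨M, hM⟩ := hE.eq_sum
    have hdE : Uᴴ * (E ⊗ₖ (1 : Matrix (Labels q c) (Labels q c) ℂ)) * U =
        (E.trace / (q : ℂ) ^ n) • (1 : Matrix (Labels q K) (Labels q K) ℂ) := by
      let P : Matrix (Labels q n) (Labels q n) ℂ → Prop := fun E =>
        Uᴴ * (E ⊗ₖ (1 : Matrix (Labels q c) (Labels q c) ℂ)) * U =
        (E.trace / (q : ℂ) ^ n) • (1 : Matrix (Labels q K) (Labels q K) ℂ)
      have hP0 : P 0 := by simp [P]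
      have hPadd : ∀ A B, P A → P B → P (A + B) := by
        intro A B hA hB
        simp only [P] at *
        rw [Matrix.add_kronecker, Matrix.mul_add, Matrix.add_mul, hA, hB, Matrix.trace_add,
          add_div, add_smul]
      have hPsmul : ∀ (t : ℂ) A, P A → P (t • A) := by
        intro t A hA
        simp only [P] at *
        rw [Matrix.smul_kronecker, Matrix.mul_smul, Matrix.smul_mul, hA, Matrix.trace_smul,
          smul_eq_mul, mul_div_assoc, smul_smul]
      change P E
      rw [hM]
      refine Finset.sum_induction _ P hPadd hP0 fun a _ =>
        Finset.sum_induction _ P hPadd hP0 fun b _ => hPsmul _ _ (hdetect _ fun i hi => ?_)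
      exact dif_neg hi
    refine ⟨E.trace / (q : ℂ) ^ n, ?_, fun _ => rfl⟩
    change U * Uᴴ * _ * (U * Uᴴ) = _ • (U * Uᴴ)
    calc U * Uᴴ * (E ⊗ₖ (1 : Matrix (Labels q c) (Labels q c) ℂ)) * (U * Uᴴ)
        = U * (Uᴴ * (E ⊗ₖ (1 : Matrix (Labels q c) (Labels q c) ℂ)) * U) * Uᴴ := by
          simp only [Matrix.mul_assoc]
      _ = _ := by rw [hdE, Matrix.mul_smul, Matrix.smul_mul, Matrix.mul_one]

/-- Entanglement-assisted codes from linear codes: the Hermitian hull measures the entanglement. -/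
theorem existsCode_of_code {F : Type*} [Field F] [Fintype F] [DecidableEq F] {q n k d h : ℕ}
    (hq : IsPrimePow q) (hF : Fintype.card F = q ^ 2) (C : Submodule F (Fin n → F))
    (hpar : HasParameters C k d) (hh : Module.finrank F ↥(hermitianDual q C ⊓ C) = h) :
    ∃ K c : ℕ, K + h = k ∧ c + k + h = n ∧ ExistsCode q n K d c := by
  classical
  obtain ⟨σ, hσ, hσσ⟩ := exists_frobenius hq hF
  obtain ⟨w⟩ := exists_weylSystem hq hF hσ hσσ
  obtain ⟨hk, hd⟩ := hpar
  set D := hermitianDual q C with hD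
  have hDk : Module.finrank F D + k = n := hk ▸ finrank_hermitianDual hσ hσσ C
  have hDD : hermitianDual q D = C := hermitianDual_hermitianDual hσ hσσ C
  let B : D → D →ₗ[F] F := fun t =>
    { toFun := fun s => ∑ i, s.1 i * σ (t.1 i)
      map_add' := fun x y => by simp [add_mul, Finset.sum_add_distrib]
      map_smul' := fun a x => by simp [mul_assoc, Finset.mul_sum] }
  have hB : ∀ s t, B t s = ∑ i, s.1 i * σ (t.1 i) := fun s t => rfl
  obtain ⟨c, φ, hφ, hφB⟩ := exists_map_to_standard (σ := σ)
    (fun a ha ha' => exists_norm_eq hq.one_lt hF hσ ha ha') (exists_trace_ne_zero hq.one_lt hF hσ)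
    _ rfl B (fun s t => by
      rw [hB, hB, map_sum]
      exact Finset.sum_congr rfl fun i _ => by rw [map_mul, hσσ, mul_comm])
  -- the kernel of `φ` is the hull
  have hker : (LinearMap.ker φ).map D.subtype = D ⊓ C := by
    ext x
    simp only [Submodule.mem_map, LinearMap.mem_ker, Submodule.subtype_apply, Submodule.mem_inf]
    constructor
    · rintro ⟨s, hs, rfl⟩
      refine ⟨s.2, ?_⟩
      rw [← hDD, mem_hermitianDual hσ]
      intro t ht
      have h1 := hφB s ⟨t, ht⟩
      rw [hs, hB] at h1
      simpa using h1.symm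
    · rintro ⟨hxD, hxC⟩
      refine ⟨⟨x, hxD⟩, ?_, rfl⟩
      ext j
      obtain ⟨t, ht⟩ := hφ (Pi.single j 1)
      have h1 := hφB ⟨x, hxD⟩ t
      rw [← hDD, mem_hermitianDual hσ] at hxC
      rw [hB, hxC t t.2, ht, Finset.sum_eq_single j] at h1
      · simpa using h1
      · intro i _ hi
        simp [Pi.single_eq_of_ne hi]
      · simp
  have hhD : c + h = Module.finrank F D := by
    have h1 := φ.finrank_range_add_finrank_ker
    rw [LinearMap.range_eq_top.2 hφ, finrank_top, Module.finrank_fin_fun] at h1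
    rw [← h1, ← hh, ← hker, Submodule.finrank_map_subtype_eq]
  have hhk : h ≤ k := by
    rw [← hh, ← hk]
    exact Submodule.finrank_mono inf_le_right
  refine ⟨k - h, c, Nat.sub_add_cancel hhk, by omega, ?_⟩
  -- the stabilizer
  let G : D →ₗ[F] (Fin n ⊕ Fin c → F) :=
    { toFun := fun s => Sum.elim s.1 (φ s)
      map_add' := fun x y => by ext (i | i) <;> simp
      map_smul' := fun a x => by ext (i | i) <;> simp }
  have hG : ∀ s, G s = Sum.elim s.1 (φ s) := fun s => rfl
  have hGinj : Function.Injective G := by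
    intro s t hst
    ext i
    exact congrFun hst (Sum.inl i)
  have hiso : ∀ s ∈ LinearMap.range G, ∀ t ∈ LinearMap.range G, ∑ i, s i * σ (t i) = 0 := by
    rintro _ ⟨s, rfl⟩ _ ⟨t, rfl⟩
    rw [Fintype.sum_sum_type]
    simp only [hG, Sum.elim_inl, Sum.elim_inr]
    rw [hφB, hB, add_neg_cancel]
  have hcard : Fintype.card (Labels q (k - h)) * Nat.card (LinearMap.range G) =
      q ^ Fintype.card (Fin n ⊕ Fin c) := by
    rw [Module.natCard_eq_pow_finrank (K := F), LinearMap.finrank_range_of_inj hGinj,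
      Nat.card_eq_fintype_card, hF, ← pow_mul]
    simp only [Labels, Fintype.card_pi_const, Fintype.card_fin, Fintype.card_sum]
    rw [← pow_add]
    congr 1
    omega
  have hq0 : q ≠ 0 := hq.ne_zero
  obtain ⟨W, -, hW⟩ := w.exists_isometry_detecting hiso hq0 hcard
  have hq1 : (q : ℂ) ≠ 0 := by exact_mod_cast hq0
  have htr : ∀ m : ℕ, ∏ _j : Fin m, (1 : Matrix (Fin q) (Fin q) ℂ).trace / (q : ℂ) = 1 := by
    simp [hq1]
  refine existsCode_of_isometry hq0 W ?_ ?_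
  · intro S hS M hM
    rw [hW (Sum.inl '' (S : Set (Fin n))) ?_ _ ?_]
    · rw [Fintype.prod_sum_type]
      exact congrArg (· • _) ((congrArg _ (htr c)).trans (mul_one _))
    · intro u hu hou
      have hur : ∀ j, u (Sum.inr j) = 0 := fun j => hu _ (by simp)
      have hul : (fun i => u (Sum.inl i)) ∈ C := by
        have h1 : (fun i => u (Sum.inl i)) ∈ hermitianDual q D := by
          rw [mem_hermitianDual hσ]
          intro s hs
          have h2 := hou (G ⟨s, hs⟩) ⟨_, rfl⟩
          rw [Fintype.sum_sum_type] at h2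
          simp only [hG, Sum.elim_inl, Sum.elim_inr, hur, map_zero, mul_zero,
            Finset.sum_const_zero, add_zero] at h2
          have h3 := congrArg σ h2
          simpa [map_sum, hσσ, mul_comm] using h3
        rwa [hDD] at h1
      have hu0 : (fun i => u (Sum.inl i)) = 0 := by
        by_contra hne
        have h1 := hd.2 ⟨_, hul, hne, rfl⟩
        have h2 : hammingNorm (fun i => u (Sum.inl i)) ≤ S.card := by
          apply Finset.card_le_card
          intro i hi
          by_contra hiS
          have h3 : u (Sum.inl i) = 0 := hu _ (by simpa using hiS)
          simp [h3] at hi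
        omega
      ext (i | j)
      · exact congrFun hu0 i
      · exact hur j
    · rintro (i | j) hi
      · exact hM i (by simpa using hi)
      · rfl
  · intro M
    rw [hW (Set.range Sum.inr) ?_ _ ?_]
    · rw [Fintype.prod_sum_type]
      exact congrArg (· • _) ((congrArg (· * _) (htr n)).trans (one_mul _))
    · intro u hu hou
      have hul : ∀ i, u (Sum.inl i) = 0 := fun i => hu _ (by simp)
      ext (i | j)
      · exact hul i
      · obtain ⟨s, hs⟩ := hφ (Pi.single j 1)
        have h2 := hou (G s) ⟨_, rfl⟩
        rw [Fintype.sum_sum_type] at h2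
        simp only [hG, Sum.elim_inl, Sum.elim_inr, hul, map_zero, mul_zero,
          Finset.sum_const_zero, zero_add, hs] at h2
        rw [Finset.sum_eq_single j] at h2
        · simpa using h2
        · intro i _ hi
          simp [Pi.single_eq_of_ne hi]
        · simp
    · rintro (i | j) hi
      · rfl
      · exact absurd ⟨j, rfl⟩ hi

end QUENTA

theorem mainTheorem2 {F : Type*} [Field F] [Fintype F] [DecidableEq F]
    {L : Type*} [Field L] [Algebra F L]
    (q n k d : ℕ) [NeZero n] (hq : IsPrimePow q) (hF : Fintype.card F = q ^ 2)
    (hn : n.Coprime q) (α : L) (hα : IsPrimitiveRoot α n)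
    (C : Submodule F (Fin n → F)) (hC : QUENTA.IsCyclicCode C)
    (hpar : QUENTA.HasParameters C k d) :
    Module.finrank F ↥(QUENTA.hermitianDual q C ⊓ C) =
      (QUENTA.definingSet α (QUENTA.hermitianDual q C) ∩ QUENTA.definingSet α C).ncard ∧
    ∃ K c : ℕ,
      K + (QUENTA.definingSet α (QUENTA.hermitianDual q C) ∩ QUENTA.definingSet α C).ncard = k ∧
      c + k +
        (QUENTA.definingSet α (QUENTA.hermitianDual q C) ∩ QUENTA.definingSet α C).ncard = n ∧
      QUENTA.ExistsCode q n K d c := by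
  have hhull : Module.finrank F ↥(QUENTA.hermitianDual q C ⊓ C) =
      (QUENTA.definingSet α (QUENTA.hermitianDual q C) ∩ QUENTA.definingSet α C).ncard := by
    obtain ⟨σ, hσ, hσσ⟩ := QUENTA.exists_frobenius hq hF
    have h1 := QUENTA.finrank_add_ncard_definingSet hα ((hC.hermitianDual q).sup hC)
    rw [QUENTA.definingSet_sup] at h1
    have h2 := Submodule.finrank_sup_add_finrank_inf_eq (QUENTA.hermitianDual q C) C
    have h3 := QUENTA.finrank_hermitianDual hσ hσσ C
    omega
  exact ⟨hhull, QUENTA.existsCode_of_code hq hF C hpar hhull⟩
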